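/- Let $X$ be a (real or complex, not necessarily Hausdorff) locally convex topological vector space, and let $C\subset X$ be a bounded convex set which is not totally bounded. Then there is a uniformly continuous map $f\colon C\to C$ which has no approximate fixed point net, i.e. there is no net $(x_i)_{i\in I}$ in $C$ such that $x_i-f(x_i)\to 0$. Here boundedness, total boundedness and uniform continuity refer to the linear topology of $X$ and the translation-invariant uniformity it induces: $C$ is bounded if it is absorbed by every neighbourhood of $0$, and totally bounded if for every neighbourhood $U$ of $0$ it is covered by finitely many translates of $U$. -/

import Mathlib

open Filter Topology

universe u

/-- A self-map `f` of a subset `C` of a topological additive group `X` has an approximate fixed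
point net: there is a net `(x i)` in `C`, indexed by a nonempty directed preorder, with
`x i - f (x i) → 0`. (Restricting the index set to the universe of `X` loses nothing, see
`hasApproxFixedPointNet_of_net`.) -/
def HasApproxFixedPointNet {X : Type u} [AddCommGroup X] [TopologicalSpace X] {C : Set X}
    (f : C → C) : Prop :=
  ∃ (ι : Type u) (_ : Preorder ι) (_ : IsDirectedOrder ι) (_ : Nonempty ι) (x : ι → C),
    Tendsto (fun i => (x i : X) - (f (x i) : X)) atTop (𝓝 0)

theorem hasApproxFixedPointNet_iff {X : Type u} [AddCommGroup X] [TopologicalSpace X] {C : Set X}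
    (f : C → C) :
    HasApproxFixedPointNet f ↔ (0 : X) ∈ closure (Set.range fun x : C => (x : X) - (f x : X)) := by
  constructor
  · rintro ⟨ι, _, _, _, x, hx⟩
    exact mem_closure_of_tendsto hx (Eventually.of_forall fun i => ⟨x i, rfl⟩)
  · intro h
    have key : ∀ U : {U : Set X // U ∈ 𝓝 (0 : X)}, ∃ x : C, (x : X) - (f x : X) ∈ U.1 := by
      rintro ⟨U, hU⟩
      obtain ⟨_, hy, x, rfl⟩ := mem_closure_iff_nhds.1 h U hU
      exact ⟨x, hy⟩
    choose x hx using key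
    refine ⟨{U : Set X // U ∈ 𝓝 (0 : X)}ᵒᵈ, inferInstance, ⟨fun U V => ?_⟩,
      ⟨OrderDual.toDual ⟨Set.univ, univ_mem⟩⟩, fun U => x (OrderDual.ofDual U), ?_⟩
    · exact ⟨OrderDual.toDual ⟨(OrderDual.ofDual U).1 ∩ (OrderDual.ofDual V).1,
        inter_mem (OrderDual.ofDual U).2 (OrderDual.ofDual V).2⟩,
        Set.inter_subset_left, Set.inter_subset_right⟩
    · intro U hU
      rw [mem_map]
      refine mem_of_superset (Ici_mem_atTop
        (OrderDual.toDual (⟨U, hU⟩ : {U : Set X // U ∈ 𝓝 (0 : X)}))) fun V hV => ?_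
      exact (show (OrderDual.ofDual V).1 ⊆ U from hV) (hx _)

/-- A net indexed in an arbitrary universe yields one as in `HasApproxFixedPointNet`. -/
theorem hasApproxFixedPointNet_of_net {X : Type u} [AddCommGroup X] [TopologicalSpace X]
    {C : Set X} (f : C → C) {ι : Type*} [Preorder ι] [IsDirectedOrder ι] [Nonempty ι] (x : ι → C)
    (hx : Tendsto (fun i => (x i : X) - (f (x i) : X)) atTop (𝓝 0)) :
    HasApproxFixedPointNet f :=
  (hasApproxFixedPointNet_iff f).2
    (mem_closure_of_tendsto hx (Eventually.of_forall fun i => ⟨x i, rfl⟩))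

/-! ### Seminorms on locally convex spaces -/

/-! Some continuous seminorm `p` already witnesses that `C` is not totally bounded. As `C` is
`p`-bounded, it does not stay `p`-close to any finite-dimensional subspace, so one can choose
greedily points `x n` of `C` at distance at least `δ` from a subspace `E n` containing the earlier
ones. The broken line through the `x n` lies in `C` and runs off to infinity: its point at time `v`
lies in `E (⌊v⌋₊ + 2)` but stays a fixed distance `c` away from `E ⌊v⌋₊`
(`IsFarSequence.le_brokenLine_sub`).

The profile of `y`, its truncated distances to the `E n`, recognises the line: there it drops from
`1` to `0` within two steps, at a place that tells the time. The map depends on the profile only. It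
pushes points of the line forward by about `5`. Points with a less sharp drop go to the line about
`5` before their drop, or, when sharpness is below `1/2`, to the segment joining `x 0` to that
point. If `y` were close to its image `z`, their profiles would nearly agree; but `z` is either
sharp where `y` is not, or drops at a clearly different place
(`IsFarSequence.exists_pos_le_sub_targetPoint`).

The image is a Lipschitz function of the profile for every continuous seminorm
(`Seminorm.targetPoint_sub_le`), and the profile is `p`-Lipschitz in `y`; this gives uniform
continuity. -/

theorem exists_continuous_seminorm_ball_subset {X : Type*} [AddCommGroup X] [Module ℝ X]
    [TopologicalSpace X] [IsTopologicalAddGroup X] [ContinuousSMul ℝ X] [LocallyConvexSpace ℝ X]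
    {U : Set X} (hU : U ∈ 𝓝 (0 : X)) :
    ∃ q : Seminorm ℝ X, Continuous q ∧ ∃ r > 0, ∀ x, q x < r → x ∈ U := by
  have hq := with_gaugeSeminormFamily (𝕜 := ℝ) (E := X)
  obtain ⟨s, r, hr, hsub⟩ := (hq.mem_nhds_iff 0 U).1 hU
  refine ⟨s.sup (gaugeSeminormFamily ℝ X), ?_, r, hr, fun x hx => hsub ?_⟩
  · exact Seminorm.continuous_finsetSup fun i _ => hq.continuous_seminorm i
  · simpa [Seminorm.mem_ball] using hx

theorem Bornology.IsVonNBounded.exists_seminorm_le {X : Type*} [AddCommGroup X] [Module ℝ X]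
    [TopologicalSpace X] {C : Set X} (hC : Bornology.IsVonNBounded ℝ C) {q : Seminorm ℝ X}
    (hq : Continuous q) : ∃ M > 0, ∀ x ∈ C, q x ≤ M := by
  have hU : q.ball 0 1 ∈ 𝓝 (0 : X) := by
    rw [Seminorm.ball_zero_eq]
    exact (isOpen_lt hq continuous_const).mem_nhds (by simp)
  obtain ⟨r, hr, h⟩ := (hC hU).exists_pos
  refine ⟨r, hr, fun x hx => ?_⟩
  obtain ⟨y, hy, rfl⟩ := h r (by simp [abs_of_pos hr]) hx
  have hy : q y < 1 := by simpa [Seminorm.mem_ball] using hy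
  simp only [map_smul_eq_mul, Real.norm_eq_abs, abs_of_pos hr]
  nlinarith

theorem exists_seminorm_forall_finite_of_not_totallyBounded {X : Type*} [AddCommGroup X]
    [Module ℝ X] [UniformSpace X] [IsUniformAddGroup X] [ContinuousSMul ℝ X]
    [LocallyConvexSpace ℝ X] {C : Set X} (hC : ¬ TotallyBounded C) :
    ∃ p : Seminorm ℝ X, Continuous p ∧ ∃ ε > 0, ∀ s : Set X, s.Finite →
      ∃ x ∈ C, ∀ y ∈ s, ε ≤ p (x - y) := by
  rw [totallyBounded_iff_subset_finite_iUnion_nhds_zero] at hC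
  push Not at hC
  obtain ⟨U, hU, h⟩ := hC
  obtain ⟨p, hp, ε, hε, hsub⟩ := exists_continuous_seminorm_ball_subset hU
  refine ⟨p, hp, ε, hε, fun s hs => ?_⟩
  obtain ⟨x, hx, hxs⟩ := Set.not_subset.1 (h s hs)
  refine ⟨x, hx, fun y hy => ?_⟩
  by_contra! hlt
  refine hxs (Set.mem_iUnion₂.2 ⟨y, hy, x - y, hsub _ hlt, ?_⟩)
  simp

/-! ### Sequences far from the span of their predecessors -/

theorem exists_finite_cover_of_near_finiteDimensional {V : Type*} [SeminormedAddCommGroup V]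
    [NormedSpace ℝ V] {C : Set V} {M ε : ℝ} (hε : 0 < ε) (hM : ∀ x ∈ C, ‖x‖ ≤ M)
    (E : Submodule ℝ V) [FiniteDimensional ℝ E] (hE : ∀ x ∈ C, ∃ y ∈ E, ‖x - y‖ < ε) :
    ∃ s : Set V, s.Finite ∧ ∀ x ∈ C, ∃ y ∈ s, ‖x - y‖ < 2 * ε := by
  -- The restriction of a seminorm to `E` need not be a norm; its Hausdorff quotient is a
  -- finite-dimensional normed space, so closed balls are compact there, and total boundedness pulls
  -- back.
  let N := SeparationQuotient E
  have : FiniteDimensional ℝ N :=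
    Module.Finite.of_surjective (SeparationQuotient.mkCLM ℝ E).toLinearMap
      SeparationQuotient.surjective_mk
  have : ProperSpace N := FiniteDimensional.proper ℝ N
  have htb : TotallyBounded (Metric.closedBall (0 : E) (M + ε)) := by
    have h := totallyBounded_preimage (SeparationQuotient.isUniformInducing_mk (α := E))
      (isCompact_closedBall (0 : N) (M + ε)).totallyBounded
    refine h.subset fun y hy => ?_
    simpa using hy
  obtain ⟨t, ht, hcov⟩ := Metric.totallyBounded_iff.1 htb ε hε
  refine ⟨(↑) '' t, ht.image _, fun x hx => ?_⟩
  obtain ⟨y, hy, hxy⟩ := hE x hx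
  have hyb : (⟨y, hy⟩ : E) ∈ Metric.closedBall (0 : E) (M + ε) := by
    rw [mem_closedBall_zero_iff, Submodule.coe_norm]
    have h1 : ‖y‖ ≤ ‖x‖ + ‖x - y‖ := norm_le_insert x y
    linarith [hM x hx]
  obtain ⟨z, hz, hyz⟩ := Set.mem_iUnion₂.1 (hcov hyb)
  refine ⟨z, ⟨z, hz, rfl⟩, ?_⟩
  rw [Metric.mem_ball, dist_eq_norm] at hyz
  have hyz : ‖y - z‖ < ε := hyz
  have h1 : ‖x - z‖ ≤ ‖x - y‖ + ‖y - z‖ := norm_sub_le_norm_sub_add_norm_sub x y z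
  linarith

theorem Seminorm.exists_forall_le_of_forall_finite {X : Type*} [AddCommGroup X] [Module ℝ X]
    (p : Seminorm ℝ X) {C : Set X} {M ε : ℝ} (hε : 0 < ε) (hM : ∀ x ∈ C, p x ≤ M)
    (hfin : ∀ s : Set X, s.Finite → ∃ x ∈ C, ∀ y ∈ s, ε ≤ p (x - y))
    (E : Submodule ℝ X) [FiniteDimensional ℝ E] :
    ∃ x ∈ C, ∀ y ∈ E, ε / 2 ≤ p (x - y) := by
  let _ : SeminormedAddCommGroup X := p.toSeminormedAddCommGroup
  let _ : NormedSpace ℝ X := ⟨fun a x => (map_smul_eq_mul p a x).le⟩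
  by_contra! h
  obtain ⟨s, hs, hcov⟩ :=
    exists_finite_cover_of_near_finiteDimensional (V := X) (half_pos hε) hM E h
  obtain ⟨x, hx, hxs⟩ := hfin s hs
  obtain ⟨y, hy, hxy⟩ := hcov x hx
  have h1 : p (x - y) < 2 * (ε / 2) := hxy
  linarith [hxs y hy]

/-- A sequence in `C` adapted to an increasing sequence of subspaces: each term lies at seminorm
distance at least `δ` from the subspace that contains its predecessors. -/
structure IsFarSequence {X : Type*} [AddCommGroup X] [Module ℝ X] (p : Seminorm ℝ X) (C : Set X)
    (δ : ℝ) (E : ℕ → Submodule ℝ X) (x : ℕ → X) : Prop where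
  mono : Monotone E
  mem : ∀ n, x n ∈ C
  mem_succ : ∀ n, x n ∈ E (n + 1)
  far : ∀ n, ∀ y ∈ E n, δ ≤ p (x n - y)

theorem exists_isFarSequence {X : Type*} [AddCommGroup X] [Module ℝ X]
    (p : Seminorm ℝ X) {C : Set X} {M ε : ℝ} (hε : 0 < ε) (hM : ∀ x ∈ C, p x ≤ M)
    (hfin : ∀ s : Set X, s.Finite → ∃ x ∈ C, ∀ y ∈ s, ε ≤ p (x - y)) :
    ∃ E x, IsFarSequence p C (ε / 2) E x := by
  classical
  have key : ∀ s : Finset X, ∃ x ∈ C, ∀ y ∈ Submodule.span ℝ (s : Set X), ε / 2 ≤ p (x - y) :=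
    fun s => p.exists_forall_le_of_forall_finite hε hM hfin _
  choose g hgC hg using key
  obtain ⟨S, hS⟩ : ∃ S : ℕ → Finset X, ∀ n, S (n + 1) = insert (g (S n)) (S n) :=
    ⟨fun n => Nat.rec ∅ (fun _ s => insert (g s) s) n, fun _ => rfl⟩
  refine ⟨fun n => Submodule.span ℝ (S n : Set X), fun n => g (S n), ?_, fun n => hgC _, ?_,
    fun n => hg _⟩
  · refine monotone_nat_of_le_succ fun n => Submodule.span_mono ?_
    rw [hS]
    exact_mod_cast Finset.subset_insert _ _
  · intro n
    refine Submodule.subset_span ?_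
    rw [hS]
    simp

/-! ### Profiles: antitone sequences in the unit interval -/

structure IsProfile (B : ℕ → ℝ) : Prop where
  antitone : Antitone B
  nonneg : ∀ n, 0 ≤ B n
  le_one : ∀ n, B n ≤ 1

/-- How close the sequence `B` comes to dropping from `1` to `0` within two steps. -/
noncomputable def sharpness (B : ℕ → ℝ) : ℝ := max 0 (4 * (⨆ n, (B n - B (n + 2))) - 3)

theorem sharpness_nonneg (B : ℕ → ℝ) : 0 ≤ sharpness B := le_max_left _ _

theorem IsProfile.bddAbove {B : ℕ → ℝ} (hB : IsProfile B) :
    BddAbove (Set.range fun n => B n - B (n + 2)) :=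
  ⟨1, by rintro _ ⟨n, rfl⟩; linarith [hB.le_one n, hB.nonneg (n + 2)]⟩

theorem IsProfile.sharpness_le_one {B : ℕ → ℝ} (hB : IsProfile B) : sharpness B ≤ 1 := by
  have : (⨆ n, (B n - B (n + 2))) ≤ 1 :=
    ciSup_le fun n => by linarith [hB.le_one n, hB.nonneg (n + 2)]
  exact max_le zero_le_one (by linarith)

theorem IsProfile.sharpness_eq_one {B : ℕ → ℝ} (hB : IsProfile B) {m : ℕ} (h1 : B m = 1)
    (h0 : B (m + 2) = 0) : sharpness B = 1 := by
  refine le_antisymm hB.sharpness_le_one ?_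
  have h : B m - B (m + 2) ≤ _ := le_ciSup hB.bddAbove m
  exact le_max_of_le_right (by linarith)

theorem IsProfile.sharpness_le_add {B B' : ℕ → ℝ} (hB' : IsProfile B') {η : ℝ}
    (hη : ∀ n, |B n - B' n| ≤ η) : sharpness B ≤ sharpness B' + 8 * η := by
  have hη0 : 0 ≤ η := (abs_nonneg _).trans (hη 0)
  have h : (⨆ n, (B n - B (n + 2))) ≤ (⨆ n, (B' n - B' (n + 2))) + 2 * η := by
    refine ciSup_le fun n => ?_
    have h1 : B' n - B' (n + 2) ≤ _ := le_ciSup hB'.bddAbove n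
    have h2 := abs_le.1 (hη n)
    have h3 := abs_le.1 (hη (n + 2))
    linarith
  refine max_le (by linarith [sharpness_nonneg B']) ?_
  have h4 : 4 * (⨆ n, (B' n - B' (n + 2))) - 3 ≤ sharpness B' := le_max_right _ _
  linarith

theorem IsProfile.abs_sharpness_sub_le {B B' : ℕ → ℝ} (hB : IsProfile B) (hB' : IsProfile B')
    {η : ℝ} (hη : ∀ n, |B n - B' n| ≤ η) : |sharpness B - sharpness B'| ≤ 8 * η := by
  have h1 := hB'.sharpness_le_add hη
  have h2 := hB.sharpness_le_add (B := B') (η := η) fun n => by rw [abs_sub_comm]; exact hη n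
  exact abs_le.2 ⟨by linarith, by linarith⟩

theorem exists_drop_of_sharpness_pos {B : ℕ → ℝ} (h : 0 < sharpness B) :
    ∃ m, 3 / 4 < B m - B (m + 2) := by
  have h1 : 0 < 4 * (⨆ n, (B n - B (n + 2))) - 3 := by
    by_contra! h'
    exact h.ne' (max_eq_left h')
  exact exists_lt_of_lt_ciSup (show 3 / 4 < ⨆ n, (B n - B (n + 2)) by linarith)

/-- The ramp from `0` on `(-∞, 1/4]` to `1` on `[3/4, ∞)`. -/
noncomputable def ramp (a : ℝ) : ℝ := max 0 (min 1 (2 * a - 1 / 2))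

theorem ramp_nonneg (a : ℝ) : 0 ≤ ramp a := le_max_left _ _

theorem ramp_le_one (a : ℝ) : ramp a ≤ 1 := max_le zero_le_one (min_le_left _ _)

theorem ramp_eq_zero {a : ℝ} (h : a ≤ 1 / 4) : ramp a = 0 :=
  max_eq_left ((min_le_right _ _).trans (by linarith))

theorem ramp_eq_one {a : ℝ} (h : 3 / 4 ≤ a) : ramp a = 1 := by
  rw [ramp, min_eq_left (by linarith), max_eq_right zero_le_one]

theorem abs_ramp_sub_le (a b : ℝ) : |ramp a - ramp b| ≤ 2 * |a - b| := by
  calc |ramp a - ramp b| ≤ |min 1 (2 * a - 1 / 2) - min 1 (2 * b - 1 / 2)| := by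
        simpa [ramp, max_comm] using
          abs_max_sub_max_le_abs (min 1 (2 * a - 1 / 2)) (min 1 (2 * b - 1 / 2)) 0
    _ ≤ |(2 * a - 1 / 2) - (2 * b - 1 / 2)| := by
        have h := abs_min_sub_min_le_max 1 (2 * a - 1 / 2) 1 (2 * b - 1 / 2)
        simpa using h
    _ = 2 * |a - b| := by
        rw [show (2 * a - 1 / 2) - (2 * b - 1 / 2) = 2 * (a - b) by ring, abs_mul, abs_two]

open Classical in
/-- The approximate place where the sequence `B` drops from `1` to `0`. -/
noncomputable def dropPosition (B : ℕ → ℝ) : ℝ :=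
  if h : ∃ m, 3 / 4 < B m - B (m + 2) then h.choose + ramp (B (h.choose + 1)) else 0

theorem exists_dropPosition_eq {B : ℕ → ℝ} (h : 0 < sharpness B) :
    ∃ m : ℕ, 3 / 4 < B m - B (m + 2) ∧ dropPosition B = m + ramp (B (m + 1)) := by
  have h' := exists_drop_of_sharpness_pos h
  exact ⟨h'.choose, h'.choose_spec, by rw [dropPosition, dif_pos h']⟩

theorem IsProfile.le_dropPosition {B : ℕ → ℝ} (hB : IsProfile B) (h : 0 < sharpness B) {k : ℕ}
    (hk : B k = 1) : (k : ℝ) - 1 ≤ dropPosition B := by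
  obtain ⟨m, hm, hs⟩ := exists_dropPosition_eq h
  have hkm : k < m + 2 := by
    by_contra! hle
    linarith [hB.antitone hle, hB.le_one m]
  have : (k : ℝ) ≤ m + 1 := by exact_mod_cast Nat.lt_succ_iff.1 hkm
  linarith [ramp_nonneg (B (m + 1))]

theorem IsProfile.dropPosition_le {B : ℕ → ℝ} (hB : IsProfile B) (h : 0 < sharpness B) {k : ℕ}
    (hk : B k = 0) : dropPosition B ≤ k := by
  obtain ⟨m, hm, hs⟩ := exists_dropPosition_eq h
  have hkm : m < k := by
    by_contra! hle
    linarith [hB.antitone hle, hB.nonneg (m + 2)]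
  have : (m : ℝ) + 1 ≤ k := by exact_mod_cast hkm
  linarith [ramp_le_one (B (m + 1))]

/-- The index chosen in `dropPosition` is not unique, but indices chosen for two nearby profiles
differ by at most one, and the ramp term makes up for that difference. -/
theorem IsProfile.abs_dropPosition_sub_le {B B' : ℕ → ℝ} (hB : IsProfile B) (hB' : IsProfile B')
    (h : 0 < sharpness B) (h' : 0 < sharpness B') {η : ℝ} (hη2 : η < 1 / 2)
    (hη : ∀ n, |B n - B' n| ≤ η) : |dropPosition B - dropPosition B'| ≤ 4 * η := by
  obtain ⟨m, hm, hs⟩ := exists_dropPosition_eq h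
  obtain ⟨m', hm', hs'⟩ := exists_dropPosition_eq h'
  have hη0 : 0 ≤ η := (abs_nonneg _).trans (hη 0)
  have hramp : ∀ n, |ramp (B n) - ramp (B' n)| ≤ 2 * η := fun n =>
    (abs_ramp_sub_le _ _).trans (by linarith [hη n])
  have e1 := hB.nonneg (m + 2)
  have e2 := hB.le_one m
  have e1' := hB'.nonneg (m' + 2)
  have e2' := hB'.le_one m'
  have hle : m' ≤ m + 1 := by
    by_contra! hlt
    have h1 := hB.antitone (show m + 2 ≤ m' from hlt)
    have h2 := abs_le.1 (hη m')
    linarith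
  have hle' : m ≤ m' + 1 := by
    by_contra! hlt
    have h1 := hB'.antitone (show m' + 2 ≤ m from hlt)
    have h2 := abs_le.1 (hη m)
    linarith
  rw [hs, hs']
  have hcases : m' = m ∨ m' = m + 1 ∨ m = m' + 1 := by omega
  rcases hcases with rfl | rfl | rfl
  · have := hramp (m' + 1)
    rw [add_sub_add_left_eq_sub]
    linarith
  -- `B' (m + 1) > 3 / 4` and `B (m + 2) < 1 / 4`, so the ramps there are `1` and `0`, and both
  -- positions lie within `2 * η` of `m + 1`.
  · have r1 := abs_le.1 (hramp (m + 1))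
    have r2 := abs_le.1 (hramp (m + 2))
    rw [ramp_eq_one (a := B' (m + 1)) (by linarith)] at r1
    rw [ramp_eq_zero (a := B (m + 2)) (by linarith)] at r2
    push_cast
    exact abs_le.2 ⟨by linarith, by linarith⟩
  · have r1 := abs_le.1 (hramp (m' + 1))
    have r2 := abs_le.1 (hramp (m' + 2))
    rw [ramp_eq_one (a := B (m' + 1)) (by linarith)] at r1
    rw [ramp_eq_zero (a := B' (m' + 2)) (by linarith)] at r2
    push_cast
    exact abs_le.2 ⟨by linarith, by linarith⟩

/-! ### The broken line through a sequence of points -/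

/-- The piecewise linear path with vertex `x n` at time `n`. -/
noncomputable def brokenLine {X : Type*} [AddCommGroup X] [Module ℝ X] (x : ℕ → X) (v : ℝ) : X :=
  x ⌊v⌋₊ + (v - ⌊v⌋₊) • (x (⌊v⌋₊ + 1) - x ⌊v⌋₊)

theorem brokenLine_mem {X : Type*} [AddCommGroup X] [Module ℝ X] {C : Set X} (hC : Convex ℝ C)
    {x : ℕ → X} (hx : ∀ n, x n ∈ C) {v : ℝ} (hv : 0 ≤ v) : brokenLine x v ∈ C := by
  refine hC.add_smul_sub_mem (hx _) (hx _) ⟨?_, ?_⟩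
  · linarith [Nat.floor_le hv]
  · linarith [Nat.lt_floor_add_one v]

theorem brokenLine_zero {X : Type*} [AddCommGroup X] [Module ℝ X] (x : ℕ → X) :
    brokenLine x 0 = x 0 := by
  simp [brokenLine]

theorem Seminorm.brokenLine_sub_le {X : Type*} [AddCommGroup X] [Module ℝ X] (q : Seminorm ℝ X)
    {C : Set X} (hC : Convex ℝ C) {x : ℕ → X} (hx : ∀ n, x n ∈ C) {D : ℝ}
    (hD : ∀ y ∈ C, ∀ z ∈ C, q (y - z) ≤ D) {v w : ℝ} (hv : 0 ≤ v) (hw : 0 ≤ w) :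
    q (brokenLine x v - brokenLine x w) ≤ D * |v - w| := by
  wlog hvw : w ≤ v generalizing v w
  · rw [map_sub_rev, abs_sub_comm]
    exact this hw hv (le_of_not_ge hvw)
  have hD0 : 0 ≤ D := (apply_nonneg q _).trans (hD _ (hx 0) _ (hx 0))
  rw [abs_of_nonneg (sub_nonneg.2 hvw)]
  have hfl : ⌊w⌋₊ ≤ ⌊v⌋₊ := Nat.floor_mono hvw
  rcases hfl.eq_or_lt with heq | hlt
  · have : brokenLine x v - brokenLine x w = (v - w) • (x (⌊w⌋₊ + 1) - x ⌊w⌋₊) := by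
      rw [brokenLine, brokenLine, ← heq]
      module
    rw [this, map_smul_eq_mul, Real.norm_of_nonneg (by linarith), mul_comm]
    exact mul_le_mul_of_nonneg_right (hD _ (hx _) _ (hx _)) (by linarith)
  · rcases (Nat.succ_le_of_lt hlt).eq_or_lt with heq | hlt'
    · have hv1 := Nat.floor_le hv
      have hw1 := Nat.lt_floor_add_one w
      have : brokenLine x v - brokenLine x w =
          (v - ⌊v⌋₊) • (x (⌊v⌋₊ + 1) - x ⌊v⌋₊) +
            ((⌊w⌋₊ : ℝ) + 1 - w) • (x (⌊w⌋₊ + 1) - x ⌊w⌋₊) := by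
        rw [brokenLine, brokenLine, ← heq]
        simp only [Nat.succ_eq_add_one]
        module
      have hc : ((⌊v⌋₊ : ℕ) : ℝ) = ⌊w⌋₊ + 1 := by rw [← heq]; push_cast; rfl
      rw [this]
      refine (map_add_le_add q _ _).trans ?_
      rw [map_smul_eq_mul, map_smul_eq_mul, Real.norm_of_nonneg (by linarith),
        Real.norm_of_nonneg (by linarith)]
      have h1 := mul_le_mul_of_nonneg_left (hD _ (hx (⌊v⌋₊ + 1)) _ (hx ⌊v⌋₊))
        (show 0 ≤ v - ⌊v⌋₊ by linarith)
      have h2 := mul_le_mul_of_nonneg_left (hD _ (hx (⌊w⌋₊ + 1)) _ (hx ⌊w⌋₊))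
        (show 0 ≤ (⌊w⌋₊ : ℝ) + 1 - w by linarith)
      rw [hc] at h1 ⊢
      nlinarith
    -- Now `v - w` exceeds `1`, so the diameter bound `D` suffices.
    · have h1 : ((⌊w⌋₊ : ℕ) : ℝ) + 2 ≤ ⌊v⌋₊ := by exact_mod_cast hlt'
      have h2 := Nat.floor_le hv
      have h3 := Nat.lt_floor_add_one w
      have h4 := hD _ (brokenLine_mem hC hx hv) _ (brokenLine_mem hC hx hw)
      nlinarith

/-! ### The map prescribed by a profile -/

/-- The time on the broken line prescribed by a profile. It lies `5` before the drop of the profile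
if the sharpness is at most `1/2` and `5` after the drop if the sharpness is `1`. -/
noncomputable def targetTime (B : ℕ → ℝ) : ℝ :=
  max 0 (dropPosition B - 5 + 20 * max 0 (sharpness B - 1 / 2))

theorem targetTime_nonneg (B : ℕ → ℝ) : 0 ≤ targetTime B := le_max_left _ _

/-- As the sharpness of the profile increases from `0` to `1/2`, this point moves on a segment from
`x 0` to the broken line, on which it then stays. -/
noncomputable def targetPoint {X : Type*} [AddCommGroup X] [Module ℝ X] (x : ℕ → X) (B : ℕ → ℝ) :
    X :=
  x 0 + min 1 (2 * sharpness B) • (brokenLine x (targetTime B) - x 0)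

theorem targetPoint_mem {X : Type*} [AddCommGroup X] [Module ℝ X] {C : Set X} (hC : Convex ℝ C)
    {x : ℕ → X} (hx : ∀ n, x n ∈ C) (B : ℕ → ℝ) : targetPoint x B ∈ C :=
  hC.add_smul_sub_mem (hx 0) (brokenLine_mem hC hx (targetTime_nonneg B))
    ⟨le_min zero_le_one (by linarith [sharpness_nonneg B]), min_le_left _ _⟩

theorem IsProfile.abs_targetTime_sub_le {B B' : ℕ → ℝ} (hB : IsProfile B) (hB' : IsProfile B')
    (h : 0 < sharpness B) (h' : 0 < sharpness B') {η : ℝ} (hη2 : η < 1 / 2)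
    (hη : ∀ n, |B n - B' n| ≤ η) : |targetTime B - targetTime B'| ≤ 164 * η := by
  have h1 := abs_le.1 (hB.abs_dropPosition_sub_le hB' h h' hη2 hη)
  have h2 := hB.abs_sharpness_sub_le hB' hη
  have h3 : |max 0 (sharpness B - 1 / 2) - max 0 (sharpness B' - 1 / 2)| ≤ 8 * η := by
    have := abs_max_sub_max_le_abs (sharpness B - 1 / 2) (sharpness B' - 1 / 2) 0
    rw [max_comm, max_comm 0 (sharpness B' - 1 / 2)]
    refine this.trans ?_
    simpa using h2
  have h3 := abs_le.1 h3
  rw [targetTime, targetTime, max_comm, max_comm 0 (dropPosition B' - _ + _)]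
  refine (abs_max_sub_max_le_abs _ _ _).trans (abs_le.2 ⟨by linarith, by linarith⟩)

/-- The drop position is uncontrolled where sharpness vanishes, but the weight `min 1 (2 * sharpness
B)` vanishes there too. The constant leaves room for `16` from the weight and `164 = 4 + 20 * 8`
from the target time. -/
theorem Seminorm.targetPoint_sub_le {X : Type*} [AddCommGroup X] [Module ℝ X] (q : Seminorm ℝ X)
    {C : Set X} (hC : Convex ℝ C) {x : ℕ → X} (hx : ∀ n, x n ∈ C) {D : ℝ}
    (hD : ∀ y ∈ C, ∀ z ∈ C, q (y - z) ≤ D) {B B' : ℕ → ℝ} (hB : IsProfile B) (hB' : IsProfile B')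
    {η : ℝ} (hη2 : η < 1 / 2) (hη : ∀ n, |B n - B' n| ≤ η) :
    q (targetPoint x B - targetPoint x B') ≤ 180 * η * D := by
  have hη0 : 0 ≤ η := (abs_nonneg _).trans (hη 0)
  have hD0 : 0 ≤ D := (apply_nonneg q _).trans (hD _ (hx 0) _ (hx 0))
  have hlam : |min 1 (2 * sharpness B) - min 1 (2 * sharpness B')| ≤ 16 * η := by
    have h := abs_min_sub_min_le_max 1 (2 * sharpness B) 1 (2 * sharpness B')
    have h2 := hB.abs_sharpness_sub_le hB' hη
    refine h.trans ?_
    rw [← mul_sub, abs_mul, abs_two, sub_self, abs_zero]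
    exact max_le (by linarith) (by linarith)
  have hl0 : 0 ≤ min 1 (2 * sharpness B') := le_min zero_le_one (by linarith [sharpness_nonneg B'])
  have hl1 : min 1 (2 * sharpness B') ≤ 1 := min_le_left _ _
  have hw : q (brokenLine x (targetTime B) - x 0) ≤ D :=
    hD _ (brokenLine_mem hC hx (targetTime_nonneg B)) _ (hx 0)
  have hprod : min 1 (2 * sharpness B') *
      q (brokenLine x (targetTime B) - brokenLine x (targetTime B')) ≤ 164 * η * D := by
    have hDη : 0 ≤ η * D := mul_nonneg hη0 hD0
    rcases (sharpness_nonneg B').eq_or_lt with h0' | h'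
    · rw [← h0']
      simpa using by linarith
    -- If `B` has sharpness `0`, the target times cannot be compared, but the weight of `B'` is at
    -- most `16 * η`.
    rcases (sharpness_nonneg B).eq_or_lt with h0 | h
    · rw [← h0] at hlam
      have h1 : min 1 (2 * sharpness B') ≤ 16 * η := by
        have := (abs_le.1 hlam).1
        simp only [mul_zero, zero_le_one, inf_of_le_right] at this
        linarith
      calc _ ≤ 16 * η * D := mul_le_mul h1 (hD _ (brokenLine_mem hC hx (targetTime_nonneg B)) _
            (brokenLine_mem hC hx (targetTime_nonneg B'))) (apply_nonneg q _) (by linarith)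
        _ ≤ _ := by linarith
    · have h1 := q.brokenLine_sub_le hC hx hD (targetTime_nonneg B) (targetTime_nonneg B')
      have h2 := hB.abs_targetTime_sub_le hB' h h' hη2 hη
      have h3 := mul_le_mul_of_nonneg_left h2 hD0
      have h4 := mul_le_mul_of_nonneg_right hl1
        (apply_nonneg q (brokenLine x (targetTime B) - brokenLine x (targetTime B')))
      linarith
  have hdecomp : targetPoint x B - targetPoint x B' =
      (min 1 (2 * sharpness B) - min 1 (2 * sharpness B')) • (brokenLine x (targetTime B) - x 0) +
        min 1 (2 * sharpness B') •
          (brokenLine x (targetTime B) - brokenLine x (targetTime B')) := by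
    rw [targetPoint, targetPoint]
    module
  rw [hdecomp]
  refine (map_add_le_add q _ _).trans ?_
  rw [map_smul_eq_mul, map_smul_eq_mul, Real.norm_of_nonneg hl0, Real.norm_eq_abs]
  have h5 := mul_le_mul hlam hw (apply_nonneg q _) (by linarith)
  linarith

/-! ### Distance to a subspace and the profile of a point -/

/-- The distance of a point to a subspace with respect to a seminorm. -/
noncomputable def Seminorm.distTo {X : Type*} [AddCommGroup X] [Module ℝ X] (p : Seminorm ℝ X)
    (E : Submodule ℝ X) (x : X) : ℝ :=
  ⨅ y : E, p (x - y)

section distTo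

variable {X : Type*} [AddCommGroup X] [Module ℝ X] (p : Seminorm ℝ X)

theorem Seminorm.distTo_le {E : Submodule ℝ X} (x : X) {y : X} (hy : y ∈ E) :
    p.distTo E x ≤ p (x - y) :=
  ciInf_le (f := fun y : E => p (x - y))
    ⟨0, by rintro _ ⟨y, rfl⟩; exact apply_nonneg p _⟩ ⟨y, hy⟩

theorem Seminorm.le_distTo {E : Submodule ℝ X} {x : X} {r : ℝ} (h : ∀ y ∈ E, r ≤ p (x - y)) :
    r ≤ p.distTo E x :=
  le_ciInf fun y => h y y.2

theorem Seminorm.distTo_nonneg (E : Submodule ℝ X) (x : X) : 0 ≤ p.distTo E x :=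
  p.le_distTo fun _ _ => apply_nonneg p _

theorem Seminorm.distTo_eq_zero {E : Submodule ℝ X} {x : X} (hx : x ∈ E) : p.distTo E x = 0 :=
  le_antisymm ((p.distTo_le x hx).trans (by simp)) (p.distTo_nonneg E x)

theorem Seminorm.distTo_anti {E E' : Submodule ℝ X} (h : E ≤ E') (x : X) :
    p.distTo E' x ≤ p.distTo E x :=
  p.le_distTo fun _ hy => p.distTo_le x (h hy)

theorem Seminorm.distTo_le_add (E : Submodule ℝ X) (x y : X) :
    p.distTo E x ≤ p.distTo E y + p (x - y) := by
  rw [← sub_le_iff_le_add]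
  refine p.le_distTo fun z hz => ?_
  have h1 := p.distTo_le x hz
  have h2 := map_add_le_add p (x - y) (y - z)
  rw [sub_add_sub_cancel] at h2
  linarith

theorem Seminorm.abs_distTo_sub_le (E : Submodule ℝ X) (x y : X) :
    |p.distTo E x - p.distTo E y| ≤ p (x - y) := by
  have h1 := p.distTo_le_add E x y
  have h2 := p.distTo_le_add E y x
  rw [map_sub_rev] at h2
  exact abs_le.2 ⟨by linarith, by linarith⟩

/-- The truncated and rescaled distances of a point to a sequence of subspaces. -/
noncomputable def Seminorm.profile (E : ℕ → Submodule ℝ X) (c : ℝ) (x : X) (n : ℕ) : ℝ :=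
  min 1 (p.distTo (E n) x / c)

theorem Seminorm.isProfile_profile {E : ℕ → Submodule ℝ X} (hE : Monotone E) {c : ℝ} (hc : 0 < c)
    (x : X) : IsProfile (p.profile E c x) where
  antitone _ _ hmn := min_le_min le_rfl
    (div_le_div_of_nonneg_right (p.distTo_anti (hE hmn) x) hc.le)
  nonneg _ := le_min zero_le_one (div_nonneg (p.distTo_nonneg _ _) hc.le)
  le_one _ := min_le_left _ _

theorem Seminorm.abs_profile_sub_le (E : ℕ → Submodule ℝ X) {c : ℝ} (hc : 0 < c)
    (x y : X) (n : ℕ) : |p.profile E c x n - p.profile E c y n| ≤ p (x - y) / c := by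
  refine (abs_min_sub_min_le_max _ _ _ _).trans ?_
  rw [← sub_div, abs_div, abs_of_pos hc, sub_self, abs_zero]
  exact max_le (div_nonneg (apply_nonneg p _) hc.le)
    (div_le_div_of_nonneg_right (p.abs_distTo_sub_le _ x y) hc.le)

theorem Seminorm.profile_eq_zero {E : ℕ → Submodule ℝ X} {c : ℝ} {x : X} {n : ℕ} (hx : x ∈ E n) :
    p.profile E c x n = 0 := by
  rw [Seminorm.profile, p.distTo_eq_zero hx, zero_div, min_eq_right zero_le_one]

theorem Seminorm.profile_eq_one {E : ℕ → Submodule ℝ X} {c : ℝ} (hc : 0 < c) {x : X} {n : ℕ}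
    (hx : ∀ y ∈ E n, c ≤ p (x - y)) : p.profile E c x n = 1 :=
  min_eq_left ((one_le_div hc).2 (p.le_distTo hx))

end distTo

section IsFarSequence

variable {X : Type*} [AddCommGroup X] [Module ℝ X] {p : Seminorm ℝ X} {C : Set X} {δ M : ℝ}
  {E : ℕ → Submodule ℝ X} {x : ℕ → X}

theorem IsFarSequence.mem_of_lt (h : IsFarSequence p C δ E x) {m n : ℕ} (hmn : m < n) :
    x m ∈ E n :=
  h.mono hmn (h.mem_succ m)

theorem IsFarSequence.brokenLine_mem (h : IsFarSequence p C δ E x) (v : ℝ) :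
    brokenLine x v ∈ E (⌊v⌋₊ + 2) :=
  (E _).add_mem (h.mem_of_lt (by omega)) ((E _).smul_mem _
    ((E _).sub_mem (h.mem_of_lt (by omega)) (h.mem_of_lt (by omega))))

/-- With `τ` the fractional part of `v`, either `τ` is large and the component along `x (m + 1)`
keeps the point away from `E (m + 1)`, or `τ` is small and `x m` dominates. The threshold `κ`
balances `τ * δ` against `(1 - τ) * δ - τ * M`. -/
theorem IsFarSequence.le_brokenLine_sub (h : IsFarSequence p C δ E x) (hδ : 0 < δ) (hM0 : 0 < M)
    (hM : ∀ y ∈ C, p y ≤ M) {v : ℝ} (hv : 0 ≤ v) {y : X} (hy : y ∈ E ⌊v⌋₊) :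
    δ * (δ / (2 * δ + M)) ≤ p (brokenLine x v - y) := by
  set m := ⌊v⌋₊
  set τ := v - m
  have hτ0 : 0 ≤ τ := sub_nonneg.2 (Nat.floor_le hv)
  have hτ1 : τ < 1 := by linarith [Nat.lt_floor_add_one v]
  have hK : 0 < 2 * δ + M := by linarith
  set κ := δ / (2 * δ + M) with hκ
  have hκ0 : 0 < κ := div_pos hδ hK
  have hκK : κ * (2 * δ + M) = δ := div_mul_cancel₀ _ hK.ne'
  rcases le_or_gt κ τ with hle | hlt
  · have hτ : 0 < τ := hκ0.trans_le hle
    have hz : τ⁻¹ • (y - (1 - τ) • x m) ∈ E (m + 1) :=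
      (E _).smul_mem _ ((E _).sub_mem (h.mono (Nat.le_succ m) hy)
        ((E _).smul_mem _ (h.mem_succ m)))
    have heq : brokenLine x v - y = τ • (x (m + 1) - τ⁻¹ • (y - (1 - τ) • x m)) := by
      rw [smul_sub, smul_inv_smul₀ hτ.ne', brokenLine]
      module
    rw [heq, map_smul_eq_mul, Real.norm_of_nonneg hτ0]
    have := h.far _ _ hz
    nlinarith
  · have hτ : 0 < 1 - τ := by linarith
    have hz : (1 - τ)⁻¹ • y ∈ E m := (E _).smul_mem _ hy
    have heq : (1 - τ) • (x m - (1 - τ)⁻¹ • y) = (brokenLine x v - y) - τ • x (m + 1) := by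
      rw [smul_sub, smul_inv_smul₀ hτ.ne', brokenLine]
      module
    have h1 := map_sub_le_add p (brokenLine x v - y) (τ • x (m + 1))
    rw [← heq, map_smul_eq_mul, map_smul_eq_mul, Real.norm_of_nonneg hτ0,
      Real.norm_of_nonneg hτ.le] at h1
    have h2 := mul_le_mul_of_nonneg_left (h.far _ _ hz) hτ.le
    have h3 := mul_le_mul_of_nonneg_left (hM _ (h.mem (m + 1))) hτ0
    have h4 := mul_le_mul_of_nonneg_right hlt.le (show 0 ≤ δ + M by linarith)
    linarith

end IsFarSequence

/-! ### Positive displacement and uniform continuity -/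

section IsFarSequence

variable {X : Type*} [AddCommGroup X] [Module ℝ X] {p : Seminorm ℝ X} {C : Set X} {δ M c : ℝ}
  {E : ℕ → Submodule ℝ X} {x : ℕ → X}

theorem IsFarSequence.profile_brokenLine_floor (h : IsFarSequence p C δ E x) (hδ : 0 < δ)
    (hM0 : 0 < M) (hM : ∀ y ∈ C, p y ≤ M) (hc : c = δ * (δ / (2 * δ + M))) {v : ℝ} (hv : 0 ≤ v) :
    p.profile E c (brokenLine x v) ⌊v⌋₊ = 1 := by
  subst hc
  exact p.profile_eq_one (by positivity) fun y hy => h.le_brokenLine_sub hδ hM0 hM hv hy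

theorem IsFarSequence.sharpness_profile_brokenLine (h : IsFarSequence p C δ E x) (hδ : 0 < δ)
    (hM0 : 0 < M) (hM : ∀ y ∈ C, p y ≤ M) (hc : c = δ * (δ / (2 * δ + M))) {v : ℝ} (hv : 0 ≤ v) :
    sharpness (p.profile E c (brokenLine x v)) = 1 :=
  (p.isProfile_profile h.mono (hc ▸ by positivity) _).sharpness_eq_one
    (h.profile_brokenLine_floor hδ hM0 hM hc hv) (p.profile_eq_zero (h.brokenLine_mem v))

theorem IsFarSequence.exists_pos_le_sub_targetPoint (h : IsFarSequence p C δ E x) (hδ : 0 < δ)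
    (hC : Convex ℝ C) (hM0 : 0 < M) (hM : ∀ y ∈ C, p y ≤ M) (hc : c = δ * (δ / (2 * δ + M))) :
    ∃ r > 0, ∀ y, r ≤ p (y - targetPoint x (p.profile E c y)) := by
  have hc0 : 0 < c := hc ▸ by positivity
  -- The last condition ensures that sharpness at most `8 * η` puts the image within `c / 1000` of
  -- `x 0`.
  obtain ⟨η, hη0, hη1, hη2⟩ : ∃ η : ℝ, 0 < η ∧ η ≤ 1 / 1000 ∧ 16000 * η * (2 * M) < c := by
    refine ⟨min (1 / 1000) (c / (40000 * M)), by positivity, min_le_left _ _, ?_⟩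
    have h1 : min (1 / 1000) (c / (40000 * M)) * (40000 * M) ≤ c :=
      (le_div_iff₀ (by positivity)).1 (min_le_right _ _)
    linarith
  refine ⟨η * c, by positivity, fun y => ?_⟩
  by_contra! hlt
  have hprof := fun w => p.isProfile_profile h.mono hc0 w
  have hlineC : ∀ {v : ℝ}, 0 ≤ v → brokenLine x v ∈ C := fun hv => _root_.brokenLine_mem hC h.mem hv
  set B := p.profile E c y with hB
  set z := targetPoint x B with hz
  have hBz : ∀ n, |B n - p.profile E c z n| ≤ η := fun n =>
    (p.abs_profile_sub_le E hc0 y z n).trans ((div_le_iff₀ hc0).2 hlt.le)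
  have hsharp := abs_le.1 ((hprof y).abs_sharpness_sub_le (hprof z) hBz)
  have hdrop := fun h1 h2 => abs_le.1
    ((hprof y).abs_dropPosition_sub_le (hprof z) h1 h2 (by linarith) hBz)
  have hv0 := targetTime_nonneg B
  rcases le_or_gt (1 / 2) (sharpness B) with hge | hlt2
  -- Here `z` has sharpness `1`, so `y` nearly does and the target time is about `5` after its drop;
  -- floor and window cost at most `2`, so `z` drops too late.
  · have hzline : z = brokenLine x (targetTime B) := by
      rw [hz, targetPoint, min_eq_left (by linarith), one_smul, add_sub_cancel]
    have hsz : sharpness (p.profile E c z) = 1 := by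
      rw [hzline]
      exact h.sharpness_profile_brokenLine hδ hM0 hM hc hv0
    have hfloor := (hprof z).le_dropPosition (by rw [hsz]; exact one_pos)
      (by rw [hzline]; exact h.profile_brokenLine_floor hδ hM0 hM hc hv0)
    have hd := hdrop (by linarith) (by linarith)
    have h1 := Nat.lt_floor_add_one (targetTime B)
    have h2 : dropPosition B - 5 + 20 * max 0 (sharpness B - 1 / 2) ≤ targetTime B :=
      le_max_right _ _
    have h3 : sharpness B - 1 / 2 ≤ max 0 (sharpness B - 1 / 2) := le_max_right _ _
    linarith
  · have htime : targetTime B = max 0 (dropPosition B - 5) := by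
      rw [targetTime, max_eq_left (a := (0 : ℝ)) (b := sharpness B - 1 / 2) (by linarith),
        mul_zero, add_zero]
    have hx0 : sharpness (p.profile E c (x 0)) = 1 := by
      rw [← brokenLine_zero x]
      exact h.sharpness_profile_brokenLine hδ hM0 hM hc le_rfl
    have hlam : min 1 (2 * sharpness B) = 2 * sharpness B := min_eq_right (by linarith)
    have hzx0 : p (x 0 - z) ≤ 2 * sharpness B * (2 * M) := by
      rw [hz, targetPoint, hlam, sub_add_cancel_left, map_neg_eq_map, map_smul_eq_mul,
        Real.norm_of_nonneg (by linarith [sharpness_nonneg B])]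
      refine mul_le_mul_of_nonneg_left ?_ (by linarith [sharpness_nonneg B])
      have h1 := map_sub_le_add p (brokenLine x (targetTime B)) (x 0)
      linarith [hM _ (hlineC hv0), hM _ (h.mem 0)]
    rcases le_or_gt (2 * sharpness B * (2 * M)) (1 / 1000 * c) with hsmall | hbig
    -- Close to `x 0`, the point `z` has sharpness nearly `1`, while that of `y` is below `1 / 2`.
    · have h1 := abs_le.1 ((hprof (x 0)).abs_sharpness_sub_le (hprof z) (η := 1 / 1000) fun n =>
        (p.abs_profile_sub_le E hc0 (x 0) z n).trans ((div_le_iff₀ hc0).2 (hzx0.trans hsmall)))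
      linarith
    · have hB8 : 8 * η < sharpness B := by
        by_contra! hle
        have := mul_le_mul_of_nonneg_right hle (show 0 ≤ 2 * M by linarith)
        linarith
      rcases le_or_gt (dropPosition B) 5 with hle5 | hgt5
      · have hzx : z = x 0 := by
          rw [hz, targetPoint, htime, max_eq_left (by linarith), brokenLine_zero, sub_self,
            smul_zero, add_zero]
        rw [hzx, hx0] at hsharp
        linarith
      -- The whole segment from `x 0` lies in this subspace, so `z` drops no later than `targetTime
      -- B + 2`, which is `3` before the drop of `y`.
      · have hzE : z ∈ E (⌊targetTime B⌋₊ + 2) :=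
          (E _).add_mem (h.mem_of_lt (by omega)) ((E _).smul_mem _
            ((E _).sub_mem (h.brokenLine_mem _) (h.mem_of_lt (by omega))))
        have h1 := (hprof z).dropPosition_le (by linarith) (p.profile_eq_zero hzE)
        have h2 := hdrop (by linarith) (by linarith)
        have h3 := Nat.floor_le hv0
        rw [htime, max_eq_right (by linarith)] at h1 h3
        push_cast at h1
        linarith

end IsFarSequence

theorem uniformContinuous_of_seminorm_lt {X : Type*} [AddCommGroup X] [Module ℝ X]
    [UniformSpace X] [IsUniformAddGroup X] [ContinuousSMul ℝ X] [LocallyConvexSpace ℝ X]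
    {C : Set X} {f : C → C} {p : Seminorm ℝ X} (hp : Continuous p)
    (hf : ∀ q : Seminorm ℝ X, Continuous q → ∀ r > 0, ∃ ε > 0, ∀ x y : C,
      p ((x : X) - y) < ε → q ((f x : X) - f y) < r) : UniformContinuous f := by
  rw [isUniformEmbedding_subtype_val.isUniformInducing.uniformContinuous_iff]
  intro W hW
  rw [uniformity_eq_comap_nhds_zero_swapped] at hW
  obtain ⟨U, hU, hUW⟩ := hW
  obtain ⟨q, hq, r, hr, hsub⟩ := exists_continuous_seminorm_ball_subset hU
  obtain ⟨ε, hε, h⟩ := hf q hq r hr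
  have hV : {w : X × X | p (w.1 - w.2) < ε} ∈ uniformity X := by
    rw [uniformity_eq_comap_nhds_zero_swapped]
    exact ⟨{w | p w < ε}, (isOpen_lt hp continuous_const).mem_nhds (by simpa), fun _ hw => hw⟩
  rw [mem_map, uniformity_subtype]
  exact mem_of_superset (preimage_mem_comap hV) fun w hw => hUW (hsub _ (h _ _ hw))

theorem exists_uniformContinuous_not_hasApproxFixedPointNet {X : Type*} [AddCommGroup X]
    [Module ℝ X] [UniformSpace X] [IsUniformAddGroup X] [ContinuousSMul ℝ X]
    [LocallyConvexSpace ℝ X] {C : Set X} (hC : Convex ℝ C) (hbdd : Bornology.IsVonNBounded ℝ C)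
    (hntb : ¬ TotallyBounded C) :
    ∃ f : C → C, UniformContinuous f ∧ ¬ HasApproxFixedPointNet f := by
  obtain ⟨p, hp, ε, hε, hfin⟩ := exists_seminorm_forall_finite_of_not_totallyBounded hntb
  obtain ⟨M, hM0, hM⟩ := hbdd.exists_seminorm_le hp
  obtain ⟨E, x, h⟩ := exists_isFarSequence p hε hM hfin
  have hδ : 0 < ε / 2 := half_pos hε
  obtain ⟨c, hc⟩ : ∃ c, c = ε / 2 * (ε / 2 / (2 * (ε / 2) + M)) := ⟨_, rfl⟩
  have hc0 : 0 < c := hc ▸ by positivity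
  obtain ⟨r, hr, hdisp⟩ := h.exists_pos_le_sub_targetPoint hδ hC hM0 hM hc
  refine ⟨fun y => ⟨targetPoint x (p.profile E c y), targetPoint_mem hC h.mem _⟩,
    uniformContinuous_of_seminorm_lt hp fun q hq ρ hρ => ?_, fun hnet => ?_⟩
  · obtain ⟨N, hN0, hN⟩ := hbdd.exists_seminorm_le hq
    have hD : ∀ y ∈ C, ∀ z ∈ C, q (y - z) ≤ 2 * N := fun y hy z hz =>
      (map_sub_le_add q y z).trans (by linarith [hN y hy, hN z hz])
    refine ⟨min (1 / 4) (ρ / (720 * N)) * c, by positivity, fun y z hyz => ?_⟩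
    refine (q.targetPoint_sub_le hC h.mem hD (p.isProfile_profile h.mono hc0 _)
      (p.isProfile_profile h.mono hc0 _) (η := min (1 / 4) (ρ / (720 * N)))
      ((min_le_left _ _).trans_lt (by norm_num)) fun n =>
        (p.abs_profile_sub_le E hc0 y z n).trans ((div_le_iff₀ hc0).2 hyz.le)).trans_lt ?_
    have h1 : min (1 / 4) (ρ / (720 * N)) * (720 * N) ≤ ρ :=
      (le_div_iff₀ (by positivity)).1 (min_le_right _ _)
    linarith
  · rw [hasApproxFixedPointNet_iff, mem_closure_iff_nhds] at hnet
    obtain ⟨_, hw, y, rfl⟩ := hnet {w | p w < r}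
      ((isOpen_lt hp continuous_const).mem_nhds (by simpa))
    exact (hdisp y).not_gt hw

theorem theorem2 {𝕜 : Type*} [RCLike 𝕜] {X : Type*} [AddCommGroup X] [Module 𝕜 X] [Module ℝ X]
    [IsScalarTower ℝ 𝕜 X] [UniformSpace X] [IsUniformAddGroup X] [ContinuousSMul 𝕜 X]
    [LocallyConvexSpace ℝ X] (C : Set X) (hconv : Convex ℝ C)
    (hbdd : Bornology.IsVonNBounded 𝕜 C) (hntb : ¬ TotallyBounded C) :
    ∃ f : C → C, UniformContinuous f ∧ ¬ HasApproxFixedPointNet f := by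
  have : ContinuousSMul ℝ X := IsScalarTower.continuousSMul 𝕜
  exact exists_uniformContinuous_not_hasApproxFixedPointNet hconv (hbdd.restrict_scalars ℝ) hntb
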